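/- Let $X$ be a finite set of $n$ points in the Euclidean plane $\mathbb{R}^2$. A range is a nonempty set of the form $X\cap d$, where $d=\{x\in\mathbb{R}^2:\|x-o\|_2\le 1\}$ is a closed unit disc with an arbitrary centre $o$. A deterministic online hitting set algorithm knows $X$ in advance and receives a finite sequence $\sigma=(r_1,\dots,r_s)$ of ranges one by one. It starts with $C_0=\emptyset$. Upon arrival of $r_i$, knowing only $X$ and $r_1,\dots,r_i$, it keeps $C_i=C_{i-1}$ if $C_{i-1}\cap r_i\neq\emptyset$, and otherwise it chooses a point $x_i\in r_i$ and sets $C_i=C_{i-1}\cup\{x_i\}$. Hence $C_1\subseteq C_2\subseteq\cdots$, and $C_i$ meets each of $r_1,\dots,r_i$. Its competitive ratio is $$\max_{\sigma}\frac{|C_s|}{|\mathrm{opt}(\sigma)|},$$ where the maximum is over all nonempty finite sequences $\sigma=(r_1,\dots,r_s)$ of ranges and $\mathrm{opt}(\sigma)\subseteq X$ is a minimum cardinality set that meets all the ranges in $\sigma$. **Theorem.** There is a deterministic online hitting set algorithm for points and unit discs whose competitive ratio is $O(\log n)$. That is, there are an absolute constant $C>0$ and an algorithm of the above kind such that, for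 every $n\ge 2$ and every set $X$ of $n$ points in the plane, its competitive ratio on $X$ is at most $C\log n$. -/

import Mathlib

open scoped ENNReal

namespace Hypergraph

variable {α : Type*}

/-- `S` stabs `r` if they have a point in common. -/
def Stabs (S : Finset α) (r : Set α) : Prop := ∃ x ∈ S, x ∈ r

/-- An input: a finite sequence of ranges (hyperedges) of `H`, in order of arrival. -/
abbrev Input (H : Hypergraph α) : Type _ := List H.edgeSet

/-- The finite set `S` of points of `H` is a hitting set for the ranges in the sequence `σ`. -/
def IsHittingSet (H : Hypergraph α) (σ : H.Input) (S : Finset α) : Prop :=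
  (S : Set α) ⊆ H.vertexSet ∧ ∀ r ∈ σ, Stabs S r.1

/-- The minimum cardinality of a hitting set for the ranges in `σ`. -/
noncomputable def opt (H : Hypergraph α) (σ : H.Input) : ℕ :=
  sInf {k : ℕ | ∃ S : Finset α, H.IsHittingSet σ S ∧ S.card = k}

/-- A deterministic online hitting set algorithm for `H`. `chosen σ` is the set held after the
ranges of `σ` have arrived in order. A range that is stabbed on arrival leaves the set unchanged;
for a range `r` that is not stabbed on arrival, one point of `r` is added. -/
structure OnlineAlgorithm (H : Hypergraph α) where
  chosen : H.Input → Finset α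
  chosen_nil : chosen [] = ∅
  chosen_of_stabs : ∀ (σ : H.Input) (r : H.edgeSet),
    Stabs (chosen σ) r.1 → chosen (σ ++ [r]) = chosen σ
  chosen_of_not_stabs : ∀ (σ : H.Input) (r : H.edgeSet),
    ¬ Stabs (chosen σ) r.1 →
      ∃ x ∈ r.1, (chosen (σ ++ [r]) : Set α) = insert x (chosen σ : Set α)

/-- The sets held by an online algorithm form a chain. -/
theorem OnlineAlgorithm.chosen_subset {H : Hypergraph α} (A : H.OnlineAlgorithm)
    (σ : H.Input) (r : H.edgeSet) :
    A.chosen σ ⊆ A.chosen (σ ++ [r]) := by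
  by_cases h : Stabs (A.chosen σ) r.1
  · rw [A.chosen_of_stabs σ r h]
  · obtain ⟨x, -, hx⟩ := A.chosen_of_not_stabs σ r h
    rw [← Finset.coe_subset, hx]
    exact Set.subset_insert _ _

/-- The set held by an online algorithm is a hitting set for the ranges that have arrived. -/
theorem OnlineAlgorithm.isHittingSet {H : Hypergraph α} (A : H.OnlineAlgorithm)
    (σ : H.Input) : H.IsHittingSet σ (A.chosen σ) := by
  induction σ using List.reverseRecOn with
  | nil => simp [IsHittingSet, A.chosen_nil]
  | append_singleton σ r ih =>
    have key : (A.chosen (σ ++ [r]) : Set α) ⊆ H.vertexSet ∧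
        Stabs (A.chosen (σ ++ [r])) r.1 := by
      by_cases h : Stabs (A.chosen σ) r.1
      · rw [A.chosen_of_stabs σ r h]
        exact ⟨ih.1, h⟩
      · obtain ⟨x, hxr, hx⟩ := A.chosen_of_not_stabs σ r h
        refine ⟨?_, x, ?_, hxr⟩
        · rw [hx]
          exact Set.insert_subset (H.subset_vertexSet_of_mem_edgeSet' r.2 hxr) ih.1
        · rw [← Finset.mem_coe, hx]
          exact Set.mem_insert _ _
    refine ⟨key.1, fun q hq => ?_⟩
    rcases List.mem_append.1 hq with hq | hq
    · obtain ⟨x, hx, hxq⟩ := ih.2 q hq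
      exact ⟨x, A.chosen_subset σ r hx, hxq⟩
    · rw [List.mem_singleton.1 hq]
      exact key.2

/-- The competitive ratio of an online algorithm: the supremum over all finite inputs of the
number of points chosen divided by the optimum. (The empty input contributes `0 / 0 = 0`; for
every other input the optimum is positive.) -/
noncomputable def OnlineAlgorithm.competitiveRatio {H : Hypergraph α}
    (A : H.OnlineAlgorithm) : ℝ≥0∞ :=
  ⨆ σ : H.Input, ((A.chosen σ).card : ℝ≥0∞) / (H.opt σ : ℝ≥0∞)

end Hypergraph

/-- The hypergraph of points and unit discs: the ground set is a finite set `X` of points in the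
Euclidean plane, and the ranges are the nonempty intersections of `X` with closed discs of
radius one. -/
def unitDiscHypergraph (X : Finset (EuclideanSpace ℝ (Fin 2))) :
    Hypergraph (EuclideanSpace ℝ (Fin 2)) where
  vertexSet := X
  edgeSet := {r | r.Nonempty ∧ ∃ o : EuclideanSpace ℝ (Fin 2),
    r = (X : Set (EuclideanSpace ℝ (Fin 2))) ∩ Metric.closedBall o 1}
  subset_vertexSet_of_mem_edgeSet' := by
    rintro r ⟨-, o, rfl⟩
    exact Set.inter_subset_left

/-- The ground set is always a hitting set, so the minimum that defines `opt` is attained. -/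
theorem unitDiscHypergraph_isHittingSet (X : Finset (EuclideanSpace ℝ (Fin 2)))
    (σ : (unitDiscHypergraph X).Input) : (unitDiscHypergraph X).IsHittingSet σ X := by
  refine ⟨subset_rfl, fun r _ => ?_⟩
  obtain ⟨x, hx⟩ := r.2.1
  exact ⟨x, (unitDiscHypergraph X).subset_vertexSet_of_mem_edgeSet' r.2 hx, hx⟩

/-!
The plane is cut into square tiles of side `1/4`. A unit disc that meets a tile is, inside that
tile, the region below a unit arc in one of the four axis directions, and two such arcs with the
same direction cross at most once. Hence the points of a tile behave like points with respect to
half-planes bounded from above: the points on the lower envelope (`envelope`) meet every range,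
and, ordered by the cross coordinate, the envelope points in a range form an interval
(`isIntervalRange_of_faces`, which rests on the concavity of `t ↦ √(1 - t ^ 2)`).

For intervals of at most `n` points, colour the `i`-th point by the exponent of `2` in `i`. Two
points of equal colour have a point of larger colour between them (`exists_rulerColouring`). If a
range selects an envelope point of largest colour, then two ranges that share an envelope point and
have the same largest colour select the same coordinate. A point `z` that is not on the envelope is
replaced by its two neighbours on the envelope, one of which lies in every range through `z`. So
the ranges through `z` fall into `O(log n)` types, and within one type every range contains the
selection of every other range (`exists_selection`).

A range selects one point in each tile that it meets, at most `81` points altogether. The algorithm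
that adds the whole selection of each range that is not yet stabbed by former selections is
`O(log n)`-competitive, since a point of an optimal hitting set accounts for at most one such range
per type. The algorithm that adds a single point per range keeps a subset of this larger set: to
stab a new range, it moves over one point of the larger set (`exists_algorithm_card_le`).
-/

namespace OnlineUnitDisc

open Finset Hypergraph

/-! ### Online algorithms from selections -/

section Online

open scoped Classical in
/-- The ranges whose selections are bought, after the arrival of `r`: the range `r` joins them if
it is not stabbed by the selections bought before. -/
noncomputable def buy {α : Type*} {H : Hypergraph α} (f : H.edgeSet → Finset α)
    (E : Finset H.edgeSet) (r : H.edgeSet) : Finset H.edgeSet :=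
  if ∃ e ∈ E, Stabs (f e) r.1 then E else insert r E

open scoped Classical in
/-- One step of the lazy algorithm. The state consists of the ranges whose selections are bought
and of the set `C` that is actually held; if `C` does not stab the new range, one bought point of
the range is added to `C`. -/
noncomputable def lazyStep {α : Type*} {H : Hypergraph α} (f : H.edgeSet → Finset α)
    (s : Finset H.edgeSet × Finset α) (r : H.edgeSet) : Finset H.edgeSet × Finset α :=
  (buy f s.1 r,
    if Stabs s.2 r.1 then s.2
    else if h : ∃ x ∈ r.1, ∃ e ∈ buy f s.1 r, x ∈ f e then insert h.choose s.2 else s.2)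

variable {α : Type*} {H : Hypergraph α} {f : H.edgeSet → Finset α}

theorem exists_mem_buy (hne : ∀ r, (f r).Nonempty) (hsub : ∀ r, ∀ x ∈ f r, x ∈ r.1)
    (E : Finset H.edgeSet) (r : H.edgeSet) : ∃ x ∈ r.1, ∃ e ∈ buy f E r, x ∈ f e := by
  unfold buy
  split_ifs with h
  · obtain ⟨e, he, x, hx, hxr⟩ := h
    exact ⟨x, hxr, e, he, hx⟩
  · obtain ⟨x, hx⟩ := hne r
    exact ⟨x, hsub r x hx, r, mem_insert_self _ _, hx⟩

theorem subset_buy (E : Finset H.edgeSet) (r : H.edgeSet) : E ⊆ buy f E r := by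
  unfold buy
  split_ifs
  · exact subset_rfl
  · exact subset_insert _ _

/-- The online algorithm that runs `lazyStep` on the arriving ranges. -/
noncomputable def lazyAlgorithm (hne : ∀ r, (f r).Nonempty) (hsub : ∀ r, ∀ x ∈ f r, x ∈ r.1) :
    H.OnlineAlgorithm where
  chosen σ := (σ.foldl (lazyStep f) (∅, ∅)).2
  chosen_nil := rfl
  chosen_of_stabs σ r h := by
    rw [List.foldl_append]
    simp only [List.foldl_cons, List.foldl_nil, lazyStep, if_pos h]
  chosen_of_not_stabs σ r h := by
    have hx := exists_mem_buy hne hsub (σ.foldl (lazyStep f) (∅, ∅)).1 r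
    refine ⟨hx.choose, hx.choose_spec.1, ?_⟩
    rw [List.foldl_append]
    simp only [List.foldl_cons, List.foldl_nil, lazyStep, if_neg h, dif_pos hx, coe_insert]

/-- The bought ranges have arrived, the set held consists of bought points, and of two bought
ranges the later one avoids the selection of the earlier one. -/
theorem lazyStep_invariant (σ : H.Input) :
    (∀ r ∈ (σ.foldl (lazyStep f) (∅, ∅)).1, r ∈ σ) ∧
    (∀ x ∈ (σ.foldl (lazyStep f) (∅, ∅)).2, ∃ e ∈ (σ.foldl (lazyStep f) (∅, ∅)).1, x ∈ f e) ∧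
    (∀ r ∈ (σ.foldl (lazyStep f) (∅, ∅)).1, ∀ r' ∈ (σ.foldl (lazyStep f) (∅, ∅)).1,
      r ≠ r' → ¬ Stabs (f r) r'.1 ∨ ¬ Stabs (f r') r.1) := by
  classical
  induction σ using List.reverseRecOn with
  | nil => simp
  | append_singleton σ r ih =>
    rw [List.foldl_append]
    simp only [List.foldl_cons, List.foldl_nil]
    obtain ⟨h1, h2, h3⟩ := ih
    set s := σ.foldl (lazyStep f) (∅, ∅)
    have hE : (lazyStep f s r).1 = buy f s.1 r := rfl
    rw [hE]
    refine ⟨fun q hq => ?_, fun x hx => ?_, fun q hq q' hq' hqq => ?_⟩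
    · unfold buy at hq
      split_ifs at hq
      · exact List.mem_append_left _ (h1 q hq)
      · rcases mem_insert.1 hq with rfl | hq
        · simp
        · exact List.mem_append_left _ (h1 q hq)
    · have old : x ∈ s.2 → ∃ e ∈ buy f s.1 r, x ∈ f e := fun hx => by
        obtain ⟨e, he, hxe⟩ := h2 x hx
        exact ⟨e, subset_buy _ _ he, hxe⟩
      unfold lazyStep at hx
      simp only at hx
      split_ifs at hx with ha hb
      · exact old hx
      · rcases mem_insert.1 hx with rfl | hx
        · exact hb.choose_spec.2
        · exact old hx
      · exact old hx
    · unfold buy at hq hq'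
      split_ifs at hq hq' with h
      · exact h3 q hq q' hq' hqq
      · push Not at h
        rcases mem_insert.1 hq with rfl | hqE <;> rcases mem_insert.1 hq' with rfl | hqE'
        · exact absurd rfl hqq
        · exact Or.inr (h q' hqE')
        · exact Or.inl (h q hqE)
        · exact h3 q hqE q' hqE' hqq

/-- Suppose that every range `r` selects a set `f r` of at most `K` of its points, and that for
every point `z` the ranges through `z` are assigned types so that ranges of equal type are stabbed
by the selections of each other. Then an online algorithm is `K * card τ`-competitive. -/
theorem exists_algorithm_card_le {τ : Type*} [Fintype τ] (f : H.edgeSet → Finset α)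
    (K : ℕ) (hne : ∀ r, (f r).Nonempty) (hsub : ∀ r, ∀ x ∈ f r, x ∈ r.1)
    (hK : ∀ r, (f r).card ≤ K) (ty : α → H.edgeSet → τ)
    (hty : ∀ z, ∀ r r' : H.edgeSet, z ∈ r.1 → z ∈ r'.1 → ty z r = ty z r' → Stabs (f r) r'.1) :
    ∃ A : H.OnlineAlgorithm, ∀ σ S, H.IsHittingSet σ S →
      (A.chosen σ).card ≤ K * Fintype.card τ * S.card := by
  classical
  refine ⟨lazyAlgorithm hne hsub, fun σ S hS => ?_⟩
  obtain ⟨h1, h2, h3⟩ := lazyStep_invariant (f := f) σ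
  change (σ.foldl (lazyStep f) (∅, ∅)).2.card ≤ _
  set s := σ.foldl (lazyStep f) (∅, ∅)
  have hz : ∀ r : H.edgeSet, ∃ z, r ∈ s.1 → z ∈ S ∧ z ∈ r.1 := fun r => by
    by_cases hr : r ∈ s.1
    · obtain ⟨z, hzS, hzr⟩ := hS.2 r (h1 r hr)
      exact ⟨z, fun _ => ⟨hzS, hzr⟩⟩
    · obtain ⟨z, -⟩ := hne r
      exact ⟨z, fun h => absurd h hr⟩
  choose z hz using hz
  have hE : s.1.card ≤ (S ×ˢ (univ : Finset τ)).card := by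
    refine card_le_card_of_injOn (fun r => (z r, ty (z r) r)) (fun r hr => ?_) ?_
    · simpa using (hz r hr).1
    · intro r hr r' hr' heq
      simp only [Prod.mk.injEq] at heq
      obtain ⟨hzz, htt⟩ := heq
      by_contra hne'
      have hr1 := (hz r hr).2
      have hr2 := (hz r' hr').2
      rw [← hzz] at hr2 htt
      rcases h3 r hr r' hr' hne' with h | h
      · exact h (hty _ r r' hr1 hr2 htt)
      · exact h (hty _ r' r hr2 hr1 htt.symm)
  calc s.2.card ≤ (s.1.biUnion f).card := card_le_card fun x hx => mem_biUnion.2 (h2 x hx)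
    _ ≤ s.1.card * K := card_biUnion_le_card_mul _ _ _ fun r _ => hK r
    _ ≤ (S ×ˢ (univ : Finset τ)).card * K := Nat.mul_le_mul_right _ hE
    _ = K * Fintype.card τ * S.card := by rw [card_product, card_univ]; ring

end Online

/-! ### Interval ranges and the ruler colouring -/

/-- Two numbers with the same exponent of `2` have a number with a larger exponent between them. -/
theorem exists_padicValNat_two_lt {i j : ℕ} (hi : 0 < i) (hij : i < j)
    (h : padicValNat 2 i = padicValNat 2 j) :
    ∃ k, i < k ∧ k < j ∧ padicValNat 2 i < padicValNat 2 k := by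
  obtain ⟨a, ha⟩ : 2 ^ padicValNat 2 i ∣ i := pow_padicValNat_dvd
  obtain ⟨b, hb⟩ : 2 ^ padicValNat 2 j ∣ j := pow_padicValNat_dvd
  have odd_part : ∀ m c : ℕ, 0 < m → m = 2 ^ padicValNat 2 m * c → c % 2 = 1 := by
    intro m c hm hc
    by_contra hcon
    obtain ⟨d, rfl⟩ : 2 ∣ c := by omega
    refine pow_succ_padicValNat_not_dvd (p := 2) hm.ne' ⟨d, ?_⟩
    rw [pow_succ, mul_assoc]
    exact hc
  have ha2 := odd_part i a hi ha
  have hb2 := odd_part j b (hi.trans hij) hb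
  rw [← h] at hb
  set v := padicValNat 2 i
  have hpos : 0 < 2 ^ v := by positivity
  have hab : a < b := by
    by_contra hcon
    have := Nat.mul_le_mul_left (2 ^ v) (not_lt.1 hcon)
    omega
  refine ⟨2 ^ v * (a + 1), ?_, ?_, ?_⟩
  · rw [ha]; exact Nat.mul_lt_mul_of_pos_left (by omega) hpos
  · rw [hb]; exact Nat.mul_lt_mul_of_pos_left (by omega) hpos
  · have hdvd : 2 ^ (v + 1) ∣ 2 ^ v * (a + 1) := by
      rw [pow_succ]
      exact Nat.mul_dvd_mul_left _ (by omega)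
    exact (padicValNat_dvd_iff_le (by positivity)).1 hdvd

/-- A finite set of reals has a colouring with logarithmically many colours in which the largest
colour of an interval is unique. -/
theorem exists_rulerColouring (S : Finset ℝ) (L : ℕ) (hL : S.card < 2 ^ (L + 1)) :
    ∃ col : ℝ → Fin (L + 1), ∀ s ∈ S, ∀ t ∈ S, s < t → col s = col t →
      ∃ m ∈ S, s < m ∧ m < t ∧ col s < col m := by
  classical
  set rank : ℝ → ℕ := fun t => (S.filter (· ≤ t)).card with hrank
  have mono : ∀ s, ∀ t ∈ S, s < t → rank s < rank t := by
    intro s t ht hst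
    refine card_lt_card ((ssubset_iff_of_subset ?_).2 ⟨t, ?_, ?_⟩)
    · exact fun x hx => by
        simp only [mem_filter] at hx ⊢
        exact ⟨hx.1, hx.2.trans hst.le⟩
    · simp [ht]
    · simp [hst]
  have pos : ∀ t ∈ S, 0 < rank t := fun t ht => card_pos.2 ⟨t, by simp [ht]⟩
  have le_card : ∀ t, rank t ≤ S.card := fun t => card_filter_le _ _
  have inj : Set.InjOn rank S := by
    intro s hs t ht h
    rcases lt_trichotomy s t with hlt | rfl | hlt
    · exact absurd h (mono s t ht hlt).ne
    · rfl
    · exact absurd h (mono t s hs hlt).ne'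
  have surj : ∀ k, 0 < k → k ≤ S.card → ∃ t ∈ S, rank t = k := by
    intro k hk hk'
    refine surj_on_of_inj_on_of_card_le (s := S) (t := Icc 1 S.card) (fun t _ => rank t)
      (fun t ht => mem_Icc.2 ⟨pos t ht, le_card t⟩) (fun s t hs ht h => inj hs ht h)
      (by simp) k (mem_Icc.2 ⟨hk, hk'⟩) |>.imp fun t ht => ?_
    exact ⟨ht.1, ht.2.symm⟩
  have bound : ∀ t, padicValNat 2 (rank t) < L + 1 := by
    intro t
    rcases Nat.eq_zero_or_pos (rank t) with h | h
    · simp [h]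
    · have h2 := Nat.le_of_dvd h (pow_padicValNat_dvd (p := 2) (n := rank t))
      exact (Nat.pow_lt_pow_iff_right (by norm_num)).1 (h2.trans_lt ((le_card t).trans_lt hL))
  refine ⟨fun t => ⟨padicValNat 2 (rank t), bound t⟩, fun s hs t ht hst h => ?_⟩
  obtain ⟨k, hk1, hk2, hk3⟩ := exists_padicValNat_two_lt (pos s hs) (mono s t ht hst)
    (congrArg Fin.val h)
  obtain ⟨m, hm, rfl⟩ := surj k (by omega) (hk2.le.trans (le_card t))
  refine ⟨m, hm, ?_, ?_, hk3⟩
  · by_contra hcon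
    rcases (not_lt.1 hcon).eq_or_lt with rfl | hlt
    · exact absurd hk1 (lt_irrefl _)
    · exact absurd (mono m s hs hlt) (by omega)
  · by_contra hcon
    rcases (not_lt.1 hcon).eq_or_lt with rfl | hlt
    · exact absurd hk2 (lt_irrefl _)
    · exact absurd (mono t m hm hlt) (by omega)

/-- The set `r` meets `H`, and it contains every point of `H` whose coordinate `x` lies between the
coordinates of two points of `r`. -/
def IsIntervalRange {α : Type*} (x : α → ℝ) (H : Finset α) (r : Set α) : Prop :=
  (∃ h ∈ H, h ∈ r) ∧ ∀ p ∈ r, ∀ q ∈ r, ∀ e ∈ H, x p ≤ x e → x e ≤ x q → e ∈ r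

/-- Interval ranges that share a point of `H` and whose points of largest colour have the same
colour contain these points of each other. -/
theorem mem_of_same_colour {α : Type*} {x : α → ℝ} {H : Finset α} {L : ℕ} {col : ℝ → Fin (L + 1)}
    (hcol : ∀ s ∈ H.image x, ∀ t ∈ H.image x, s < t → col s = col t →
      ∃ m ∈ H.image x, s < m ∧ m < t ∧ col s < col m)
    {r r' : Set α} (hr : IsIntervalRange x H r) (hr' : IsIntervalRange x H r')
    {e g g' : α} (her : e ∈ r) (her' : e ∈ r') (hg : g ∈ H) (hgr : g ∈ r)
    (hmax : ∀ h ∈ H, h ∈ r → col (x h) ≤ col (x g)) (hg' : g' ∈ H) (hgr' : g' ∈ r')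
    (hmax' : ∀ h ∈ H, h ∈ r' → col (x h) ≤ col (x g')) (heq : col (x g) = col (x g')) :
    g ∈ r' := by
  have hxg := mem_image_of_mem x hg
  have hxg' := mem_image_of_mem x hg'
  rcases lt_trichotomy (x g) (x g') with hlt | hxx | hlt
  · obtain ⟨m, hm, h1, h2, h3⟩ := hcol _ hxg _ hxg' hlt heq
    obtain ⟨k, hk, rfl⟩ := mem_image.1 hm
    rcases le_total (x k) (x e) with hke | hke
    · exact absurd (hmax k hk (hr.2 g hgr e her k hk h1.le hke)) (not_le.2 h3)
    · exact absurd (hmax' k hk (hr'.2 e her' g' hgr' k hk hke h2.le)) (not_le.2 (heq ▸ h3))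
  · exact hr'.2 g' hgr' g' hgr' g hg hxx.ge hxx.le
  · obtain ⟨m, hm, h1, h2, h3⟩ := hcol _ hxg' _ hxg hlt heq.symm
    obtain ⟨k, hk, rfl⟩ := mem_image.1 hm
    rcases le_total (x k) (x e) with hke | hke
    · exact absurd (hmax' k hk (hr'.2 g' hgr' e her' k hk h1.le hke)) (not_le.2 h3)
    · exact absurd (hmax k hk (hr.2 e her g hgr k hk hke h2.le)) (not_le.2 (heq.symm ▸ h3))

/-- Every interval range selects one of its points so that the interval ranges through any
point `z` fall into logarithmically many types, and ranges of equal type contain the selected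
points of each other. The type consists of the largest colour in the range and of a bit that tells
on which side of `z` the neighbour of `z` in `H` is known to belong to the range. -/
theorem exists_selection {α : Type*} [Nonempty α] (x : α → ℝ) (H : Finset α) (L : ℕ)
    (hL : H.card < 2 ^ (L + 1)) :
    ∃ (g : Set α → α) (ty : α → Set α → Fin (L + 1) × Bool),
      (∀ r, IsIntervalRange x H r → g r ∈ r) ∧
      ∀ z r r', IsIntervalRange x H r → IsIntervalRange x H r' → z ∈ r → z ∈ r' →
        ty z r = ty z r' → g r ∈ r' := by
  classical
  obtain ⟨col, hcol⟩ := exists_rulerColouring (H.image x) L (card_image_le.trans_lt hL)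
  have hg : ∀ r, ∃ g, IsIntervalRange x H r →
      g ∈ H ∧ g ∈ r ∧ ∀ h ∈ H, h ∈ r → col (x h) ≤ col (x g) := by
    intro r
    by_cases hr : IsIntervalRange x H r
    · obtain ⟨h, hh, hhr⟩ := hr.1
      obtain ⟨g, hg, hgmax⟩ := exists_max_image (H.filter (· ∈ r)) (fun h => col (x h))
        ⟨h, mem_filter.2 ⟨hh, hhr⟩⟩
      rw [mem_filter] at hg
      exact ⟨g, fun _ => ⟨hg.1, hg.2, fun k hk hkr => hgmax k (mem_filter.2 ⟨hk, hkr⟩)⟩⟩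
    · exact ⟨Classical.arbitrary α, fun h => absurd h hr⟩
  choose g hg using hg
  refine ⟨g, fun z r => (col (x (g r)), decide (∃ h ∈ H, h ∈ r ∧ x h ≤ x z)),
    fun r hr => (hg r hr).2.1, fun z r r' hr hr' hz hz' heq => ?_⟩
  simp only [Prod.mk.injEq, decide_eq_decide] at heq
  obtain ⟨hcc, hside⟩ := heq
  suffices ∃ e, e ∈ r ∧ e ∈ r' by
    obtain ⟨e, her, her'⟩ := this
    obtain ⟨a1, a2, a3⟩ := hg r hr
    obtain ⟨b1, b2, b3⟩ := hg r' hr'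
    exact mem_of_same_colour hcol hr hr' her her' a1 a2 a3 b1 b2 b3 hcc
  by_cases hleft : ∃ h ∈ H, h ∈ r ∧ x h ≤ x z
  -- the last point of `H` that is not to the right of `z` lies in both ranges
  · obtain ⟨h, hh, hhr, hhz⟩ := hleft
    obtain ⟨h', hh', hhr', hhz'⟩ := hside.1 ⟨h, hh, hhr, hhz⟩
    obtain ⟨e, he, hemax⟩ := exists_max_image (H.filter (x · ≤ x z)) x
      ⟨h, mem_filter.2 ⟨hh, hhz⟩⟩
    rw [mem_filter] at he
    exact ⟨e, hr.2 h hhr z hz e he.1 (hemax h (mem_filter.2 ⟨hh, hhz⟩)) he.2,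
      hr'.2 h' hhr' z hz' e he.1 (hemax h' (mem_filter.2 ⟨hh', hhz'⟩)) he.2⟩
  -- the first point of `H` that is not to the left of `z` lies in both ranges
  · have hright : ∀ s, IsIntervalRange x H s → (¬ ∃ h ∈ H, h ∈ s ∧ x h ≤ x z) →
        ∃ h ∈ H, h ∈ s ∧ x z ≤ x h := by
      intro s hs hno
      obtain ⟨h, hh, hhs⟩ := hs.1
      exact ⟨h, hh, hhs, le_of_not_ge fun hle => hno ⟨h, hh, hhs, hle⟩⟩
    obtain ⟨h, hh, hhr, hhz⟩ := hright r hr hleft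
    obtain ⟨h', hh', hhr', hhz'⟩ := hright r' hr' (fun h => hleft (hside.2 h))
    obtain ⟨e, he, hemin⟩ := exists_min_image (H.filter (x z ≤ x ·)) x
      ⟨h, mem_filter.2 ⟨hh, hhz⟩⟩
    rw [mem_filter] at he
    exact ⟨e, hr.2 z hz h hhr e he.1 he.2 (hemin h (mem_filter.2 ⟨hh, hhz⟩)),
      hr'.2 z hz' h' hhr' e he.1 he.2 (hemin h' (mem_filter.2 ⟨hh', hhz'⟩))⟩

/-! ### Unit discs inside a small tile -/

/-- The plane. -/
abbrev Plane : Type := EuclideanSpace ℝ (Fin 2)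

/-- The square of the grid of mesh `1/4` that contains `p`. -/
noncomputable def tile (p : Plane) : ℤ × ℤ := (⌊4 * p 0⌋, ⌊4 * p 1⌋)

/-- The coordinate of `p` across the axis direction `d`. The first component of `d` tells whether
the direction is horizontal, the second one whether it is positive. -/
def cross (d : Bool × Bool) (p : Plane) : ℝ := if d.1 then p 1 else p 0

/-- The coordinate of `p` along the axis direction `d`. -/
def height (d : Bool × Bool) (p : Plane) : ℝ :=
  (if d.2 then 1 else -1) * (if d.1 then p 0 else p 1)

/-- The height of the centre of the unit disc that has cross coordinate `a` and whose upper arc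
passes through `p`. It is meaningful only if the cross coordinate of `p` differs from `a` by at most
one; otherwise the square root has its junk value `0`. -/
noncomputable def arcHeight (d : Bool × Bool) (p : Plane) (a : ℝ) : ℝ :=
  height d p - √(1 - (cross d p - a) ^ 2)

/-- The points of `P` that are touched first by a disc that is raised in the direction `d` with
some fixed cross coordinate of its centre. -/
noncomputable def envelope (d : Bool × Bool) (P : Finset Plane) : Finset Plane :=
  open scoped Classical in P.filter fun e => ∃ a, (∀ p ∈ P, |cross d p - a| ≤ 1) ∧
    ∀ p ∈ P, arcHeight d e a ≤ arcHeight d p a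

/-- A condition under which the unit disc with centre `o` is, inside the tile `T`, the region below
its upper arc with respect to the direction `d`: the arc spans the tile, and the part of the tile
that is lower than the centre belongs to the disc. -/
def Faces (d : Bool × Bool) (T : ℤ × ℤ) (o : Plane) : Prop :=
  ∀ p, tile p = T → |cross d p - cross d o| ≤ 1 ∧
    (height d o ≤ height d p ∨ p ∈ Metric.closedBall o 1)

theorem mem_closedBall_iff_coord {p o : Plane} :
    p ∈ Metric.closedBall o 1 ↔ (p 0 - o 0) ^ 2 + (p 1 - o 1) ^ 2 ≤ 1 := by
  rw [Metric.mem_closedBall, EuclideanSpace.dist_eq, Real.sqrt_le_one]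
  simp [Fin.sum_univ_two, Real.dist_eq, sq_abs]

theorem mem_closedBall_iff_cross_height (d : Bool × Bool) {p o : Plane} :
    p ∈ Metric.closedBall o 1 ↔
      (cross d p - cross d o) ^ 2 + (height d p - height d o) ^ 2 ≤ 1 := by
  rw [mem_closedBall_iff_coord]
  rcases d with ⟨_ | _, _ | _⟩ <;> simp [cross, height] <;> ring_nf

theorem abs_sub_le_of_tile_eq {p q : Plane} (h : tile p = tile q) (d : Bool × Bool) :
    |cross d p - cross d q| ≤ 1 / 4 ∧ |height d p - height d q| ≤ 1 / 4 := by
  have key : ∀ i, ⌊4 * p i⌋ = ⌊4 * q i⌋ → |p i - q i| ≤ 1 / 4 := by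
    intro i hi
    have := Int.abs_sub_lt_one_of_floor_eq_floor hi
    rw [abs_lt] at this
    rw [abs_le]
    constructor <;> linarith
  have h0 := abs_le.1 (key 0 (congrArg Prod.fst h))
  have h1 := abs_le.1 (key 1 (congrArg Prod.snd h))
  rcases d with ⟨_ | _, _ | _⟩ <;> simp only [cross, height, abs_le] <;>
    refine ⟨⟨?_, ?_⟩, ?_, ?_⟩ <;> simp <;> linarith

/-- Some axis direction from the centre to a point of the disc makes the height difference dominate
the cross difference. -/
theorem exists_dominant_direction (p o : Plane) :
    ∃ d, |cross d p - cross d o| ≤ height d p - height d o := by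
  rcases le_total |p 0 - o 0| |p 1 - o 1| with h | h
  · rcases abs_choice (p 1 - o 1) with h1 | h1
    · exact ⟨(false, true), by simp [cross, height]; linarith⟩
    · exact ⟨(false, false), by simp [cross, height]; linarith⟩
  · rcases abs_choice (p 0 - o 0) with h1 | h1
    · exact ⟨(true, true), by simp [cross, height]; linarith⟩
    · exact ⟨(true, false), by simp [cross, height]; linarith⟩

/-- A disc that meets a tile faces it in some axis direction, because the tile is small compared with
the disc: if some point of the tile is not above the centre, then the disc covers the tile. -/
theorem exists_faces {q o : Plane} (hq : q ∈ Metric.closedBall o 1) :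
    ∃ d, Faces d (tile q) o := by
  obtain ⟨d, hd⟩ := exists_dominant_direction q o
  refine ⟨d, fun p hp => ?_⟩
  rw [mem_closedBall_iff_cross_height d] at hq ⊢
  obtain ⟨hc, hh⟩ := abs_sub_le_of_tile_eq hp d
  rw [abs_le] at hc hh hd
  have hcross : |cross d q - cross d o| ≤ 3 / 4 := by
    have : (cross d q - cross d o) ^ 2 ≤ (height d q - height d o) ^ 2 :=
      sq_le_sq' (by linarith [hd.1]) hd.2
    exact abs_le_of_sq_le_sq (by nlinarith) (by norm_num)
  rw [abs_le] at hcross ⊢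
  refine ⟨⟨by linarith, by linarith⟩, ?_⟩
  by_cases hlow : height d o ≤ height d p
  · exact Or.inl hlow
  -- `q` is then so close to `o` that the whole tile lies in the disc
  · right
    have h1 : (cross d p - cross d o) ^ 2 ≤ (1 / 2) ^ 2 :=
      sq_le_sq' (by linarith) (by linarith)
    have h2 : (height d p - height d o) ^ 2 ≤ (1 / 2) ^ 2 :=
      sq_le_sq' (by linarith) (by linarith)
    linarith

theorem Faces.mem_closedBall_iff {d : Bool × Bool} {T : ℤ × ℤ} {o p : Plane}
    (h : Faces d T o) (hp : tile p = T) :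
    p ∈ Metric.closedBall o 1 ↔ arcHeight d p (cross d o) ≤ height d o := by
  obtain ⟨hc, hor⟩ := h p hp
  have hnn : 0 ≤ 1 - (cross d p - cross d o) ^ 2 := by
    rw [sub_nonneg, sq_le_one_iff_abs_le_one]; exact hc
  rw [arcHeight, sub_le_comm]
  constructor
  · intro hb
    rw [mem_closedBall_iff_cross_height d] at hb
    exact Real.le_sqrt_of_sq_le (by linarith)
  · intro hb
    rcases hor with hor | hor
    · rw [mem_closedBall_iff_cross_height d]
      have := (Real.le_sqrt (by linarith) hnn).1 hb
      linarith
    · exact hor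

/-- By concavity, an increment of `√(1 - t ^ 2)` decreases when it is shifted to the right. -/
theorem sqrt_one_sub_sq_increment {s t u v : ℝ} (hs : -1 ≤ s) (hv : v ≤ 1) (hst : s ≤ t)
    (hsu : s ≤ u) (hsum : s + v = t + u) :
    √(1 - s ^ 2) + √(1 - v ^ 2) ≤ √(1 - t ^ 2) + √(1 - u ^ 2) := by
  have hconc : ConcaveOn ℝ (Set.Icc (-1) 1) fun t : ℝ => √(1 - t ^ 2) := by
    refine ⟨convex_Icc _ _, fun a ha b hb m n hm hn hmn => ?_⟩
    have ha' : 0 ≤ 1 - a ^ 2 := by nlinarith [ha.1, ha.2]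
    have hb' : 0 ≤ 1 - b ^ 2 := by nlinarith [hb.1, hb.2]
    simp only [smul_eq_mul]
    refine (Real.strictConcaveOn_sqrt.concaveOn.2 ha' hb' hm hn hmn).trans (Real.sqrt_le_sqrt ?_)
    simp only [smul_eq_mul]
    obtain rfl : n = 1 - m := by linarith
    nlinarith [mul_nonneg (mul_nonneg hm hn) (sq_nonneg (a - b))]
  rcases (show s ≤ v by linarith).eq_or_lt with rfl | hlt
  · obtain rfl : t = s := by linarith
    obtain rfl : u = t := by linarith
    exact le_rfl
  · have hpos : 0 < v - s := by linarith
    have hsI : s ∈ Set.Icc (-1 : ℝ) 1 := ⟨hs, by linarith⟩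
    have hvI : v ∈ Set.Icc (-1 : ℝ) 1 := ⟨by linarith, hv⟩
    -- `t` and `u` are complementary convex combinations of `s` and `v`
    have ht0 : 0 ≤ (v - t) / (v - s) := div_nonneg (by linarith) hpos.le
    have hu0 : 0 ≤ (t - s) / (v - s) := div_nonneg (by linarith) hpos.le
    have h1 := hconc.2 hsI hvI ht0 hu0 (by field_simp; ring)
    have h2 := hconc.2 hsI hvI hu0 ht0 (by field_simp; ring)
    simp only [smul_eq_mul] at h1 h2
    have e1 : (v - t) / (v - s) * s + (t - s) / (v - s) * v = t := by field_simp; ring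
    have e2 : (t - s) / (v - s) * s + (v - t) / (v - s) * v = u := by
      obtain rfl : u = s + v - t := by linarith
      field_simp; ring
    have e3 : (v - t) / (v - s) = 1 - (t - s) / (v - s) := by field_simp; ring
    rw [e1] at h1
    rw [e2] at h2
    rw [e3] at h1 h2
    linarith

/-- The arcs of two points cross at most once: the arc of the point with the smaller cross
coordinate is the lower one first. -/
theorem arcHeight_sub_le {d : Bool × Bool} {p q : Plane} {a b : ℝ}
    (hpq : cross d p ≤ cross d q) (hab : a ≤ b) (hp : |cross d p - b| ≤ 1)
    (hq : |cross d q - a| ≤ 1) :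
    arcHeight d p a - arcHeight d q a ≤ arcHeight d p b - arcHeight d q b := by
  have := sqrt_one_sub_sq_increment (s := cross d p - b) (t := cross d p - a)
    (u := cross d q - b) (v := cross d q - a) (abs_le.1 hp).1 (abs_le.1 hq).2
    (by linarith) (by linarith) (by ring)
  unfold arcHeight
  linarith

/-- The part of a unit disc inside a tile is an interval range for the envelope. -/
theorem isIntervalRange_of_faces {d : Bool × Bool} {T : ℤ × ℤ} {o : Plane} {P : Finset Plane}
    (hP : ∀ p ∈ P, tile p = T) (hF : Faces d T o) {q : Plane} (hqP : q ∈ P)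
    (hq : q ∈ Metric.closedBall o 1) :
    IsIntervalRange (cross d) (envelope d P) {p | p ∈ P ∧ p ∈ Metric.closedBall o 1} := by
  classical
  constructor
  · obtain ⟨e, he, hmin⟩ := exists_min_image P (fun p => arcHeight d p (cross d o)) ⟨q, hqP⟩
    refine ⟨e, mem_filter.2 ⟨he, cross d o, fun p hp => (hF p (hP p hp)).1, hmin⟩, he, ?_⟩
    rw [hF.mem_closedBall_iff (hP e he)]
    exact (hmin q hqP).trans ((hF.mem_closedBall_iff (hP q hqP)).1 hq)
  · rintro p ⟨hp, hpo⟩ r ⟨hr, hro⟩ e he hpe her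
    obtain ⟨heP, a, ha, hmin⟩ := mem_filter.1 he
    refine ⟨heP, ?_⟩
    rw [hF.mem_closedBall_iff (hP _ ‹_›)] at hpo hro ⊢
    rcases le_total (cross d o) a with hoa | hoa
    · have := arcHeight_sub_le her hoa (ha e heP) (hF r (hP r hr)).1
      linarith [hmin r hr]
    · have := arcHeight_sub_le hpe hoa (hF p (hP p hp)).1 (ha e heP)
      linarith [hmin p hp]

/-! ### Selections for unit discs -/

/-- The tiles that a unit disc with centre `o` can meet. -/
noncomputable def nearTiles (o : Plane) : Finset (ℤ × ℤ) :=
  Icc ⌊4 * (o 0 - 1)⌋ ⌊4 * (o 0 + 1)⌋ ×ˢ Icc ⌊4 * (o 1 - 1)⌋ ⌊4 * (o 1 + 1)⌋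

theorem card_nearTiles (o : Plane) : (nearTiles o).card = 81 := by
  have h : ∀ t : ℝ, ⌊4 * (t + 1)⌋ = ⌊4 * (t - 1)⌋ + 8 := fun t => by
    rw [← Int.floor_add_ofNat]
    congr 1
    ring
  rw [nearTiles, card_product, Int.card_Icc, Int.card_Icc, h, h]
  have h9 : ∀ m : ℤ, (m + 8 + 1 - m).toNat = 9 := fun m => by omega
  rw [h9, h9]

theorem tile_mem_nearTiles {p o : Plane} (h : p ∈ Metric.closedBall o 1) :
    tile p ∈ nearTiles o := by
  rw [mem_closedBall_iff_coord] at h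
  have h0 : |p 0 - o 0| ≤ 1 := by
    rw [← sq_le_one_iff_abs_le_one]; linarith [sq_nonneg (p 1 - o 1)]
  have h1 : |p 1 - o 1| ≤ 1 := by
    rw [← sq_le_one_iff_abs_le_one]; linarith [sq_nonneg (p 0 - o 0)]
  rw [abs_le] at h0 h1
  simp only [nearTiles, tile, mem_product, mem_Icc]
  exact ⟨⟨Int.floor_le_floor (by linarith), Int.floor_le_floor (by linarith)⟩,
    ⟨Int.floor_le_floor (by linarith), Int.floor_le_floor (by linarith)⟩⟩

/-- The type of a range through `z` is the direction in which its disc faces the tile of `z`,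
together with the type that `exists_selection` gives for this tile and this direction. -/
theorem exists_unitDisc_algorithm (X : Finset Plane) :
    ∃ A : (unitDiscHypergraph X).OnlineAlgorithm, ∀ σ S,
      (unitDiscHypergraph X).IsHittingSet σ S →
        (A.chosen σ).card ≤ 81 * (8 * (Nat.log 2 X.card + 1)) * S.card := by
  classical
  set L := Nat.log 2 X.card
  let P : ℤ × ℤ → Finset Plane := fun T => X.filter (tile · = T)
  have hP : ∀ T, ∀ p ∈ P T, tile p = T := fun T p hp => (mem_filter.1 hp).2
  have hcard : ∀ T d, (envelope d (P T)).card < 2 ^ (L + 1) := fun T d =>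
    (card_le_card ((filter_subset _ _).trans (filter_subset _ _))).trans_lt
      (Nat.lt_pow_succ_log_self (by norm_num) X.card)
  choose g ty hg hty using fun T d => exists_selection (cross d) (envelope d (P T)) L (hcard T d)
  have hcentre : ∀ r : (unitDiscHypergraph X).edgeSet, ∃ o : Plane,
      r.1 = (X : Set Plane) ∩ Metric.closedBall o 1 := fun r => r.2.2
  choose o ho using hcentre
  -- the part of the range `r` inside the tile `T`
  let part : ℤ × ℤ → (unitDiscHypergraph X).edgeSet → Set Plane :=
    fun T r => {p | p ∈ P T ∧ p ∈ Metric.closedBall (o r) 1}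
  have mem_part : ∀ {p T r}, p ∈ part T r ↔ tile p = T ∧ p ∈ r.1 := by
    intro p T r
    rw [ho r]
    simp only [part, P, Set.mem_ofPred_eq, mem_filter, Set.mem_inter_iff, mem_coe]
    tauto
  have hdir : ∀ T r, ∃ d, (part T r).Nonempty →
      IsIntervalRange (cross d) (envelope d (P T)) (part T r) := by
    intro T r
    by_cases h : (part T r).Nonempty
    · obtain ⟨q, hqP, hq⟩ := h
      obtain ⟨d, hd⟩ := exists_faces hq
      rw [hP T q hqP] at hd
      exact ⟨d, fun _ => isIntervalRange_of_faces (hP T) hd hqP hq⟩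
    · exact ⟨(true, true), fun h' => absurd h' h⟩
  choose dir hdir using hdir
  let pick : (unitDiscHypergraph X).edgeSet → ℤ × ℤ → Plane :=
    fun r T => g T (dir T r) (part T r)
  have hpick : ∀ r T, (part T r).Nonempty → pick r T ∈ part T r :=
    fun r T h => hg T (dir T r) _ (hdir T r h)
  let f : (unitDiscHypergraph X).edgeSet → Finset Plane :=
    fun r => ((nearTiles (o r)).filter fun T => (part T r).Nonempty).image (pick r)
  have pick_mem : ∀ r z, z ∈ r.1 → pick r (tile z) ∈ f r := by
    intro r z hz
    refine mem_image_of_mem _ (mem_filter.2 ⟨tile_mem_nearTiles ?_, z, mem_part.2 ⟨rfl, hz⟩⟩)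
    rw [ho r] at hz
    exact hz.2
  obtain ⟨A, hA⟩ := exists_algorithm_card_le
    (τ := (Bool × Bool) × Fin (L + 1) × Bool) f 81
    (fun r => by
      obtain ⟨z, hz⟩ := r.2.1
      exact ⟨_, pick_mem r z hz⟩)
    (fun r x hx => by
      obtain ⟨T, hT, rfl⟩ := mem_image.1 hx
      exact (mem_part.1 (hpick r T (mem_filter.1 hT).2)).2)
    (fun r => card_image_le.trans ((card_filter_le _ _).trans (card_nearTiles _).le))
    (fun z r => (dir (tile z) r, ty (tile z) (dir (tile z) r) z (part (tile z) r)))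
    (fun z r r' hz hz' heq => by
      simp only [Prod.mk.injEq] at heq
      obtain ⟨hd, ht⟩ := heq
      have hzr : z ∈ part (tile z) r := mem_part.2 ⟨rfl, hz⟩
      have hzr' : z ∈ part (tile z) r' := mem_part.2 ⟨rfl, hz'⟩
      have hI := hdir _ _ ⟨z, hzr⟩
      have hI' := hdir _ _ ⟨z, hzr'⟩
      rw [← hd] at ht hI'
      exact ⟨_, pick_mem r z hz, (mem_part.1 (hty _ _ z _ _ hI hI' hzr hzr' ht)).2⟩)
  refine ⟨A, fun σ S hS => (hA σ S hS).trans (le_of_eq ?_)⟩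
  simp only [Fintype.card_prod, Fintype.card_bool, Fintype.card_fin]
  ring

end OnlineUnitDisc

theorem mainTheorem6 :
    ∃ (C : ℝ) (_ : 0 < C)
      (A : ∀ X : Finset (EuclideanSpace ℝ (Fin 2)), (unitDiscHypergraph X).OnlineAlgorithm),
      ∀ X : Finset (EuclideanSpace ℝ (Fin 2)), 2 ≤ X.card →
        (A X).competitiveRatio ≤ ENNReal.ofReal (C * Real.log (X.card : ℝ)) := by
  have hlog2 : 0 < Real.log 2 := Real.log_pos (by norm_num)
  choose A hA using OnlineUnitDisc.exists_unitDisc_algorithm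
  refine ⟨1296 / Real.log 2, by positivity, A, fun X hX => iSup_le fun σ => ?_⟩
  obtain ⟨S, hS, hcard⟩ : (unitDiscHypergraph X).opt σ ∈
      {k : ℕ | ∃ S : Finset _, (unitDiscHypergraph X).IsHittingSet σ S ∧ S.card = k} :=
    Nat.sInf_mem ⟨X.card, X, unitDiscHypergraph_isHittingSet X σ, rfl⟩
  refine ENNReal.div_le_of_le_mul ?_
  have hX2 : (2 : ℝ) ≤ X.card := by exact_mod_cast hX
  have h1 : (Nat.log 2 X.card : ℝ) ≤ Real.log X.card / Real.log 2 := by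
    have := Real.natLog_le_logb X.card 2
    rwa [← Real.log_div_log] at this
  have h2 : 1 ≤ Real.log X.card / Real.log 2 := by
    rw [one_le_div hlog2]
    exact Real.log_le_log (by norm_num) hX2
  have hbound : ((81 * (8 * (Nat.log 2 X.card + 1)) : ℕ) : ENNReal) ≤
      ENNReal.ofReal (1296 / Real.log 2 * Real.log X.card) := by
    rw [← ENNReal.ofReal_natCast]
    refine ENNReal.ofReal_le_ofReal ?_
    have : 1296 / Real.log 2 * Real.log X.card = 1296 * (Real.log X.card / Real.log 2) := by ring
    rw [this]
    push_cast
    linarith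
  calc (((A X).chosen σ).card : ENNReal)
      ≤ ((81 * (8 * (Nat.log 2 X.card + 1)) * (unitDiscHypergraph X).opt σ : ℕ) : ENNReal) := by
        rw [← hcard]
        exact_mod_cast hA X σ S hS
    _ ≤ ENNReal.ofReal (1296 / Real.log 2 * Real.log X.card) *
          ((unitDiscHypergraph X).opt σ : ENNReal) := by
        rw [Nat.cast_mul]
        gcongr
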